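/- Let $n\ge 1$, let $\varSigma$ be the set of $n\times n$ (row-)stochastic real matrices, and let $\{X_t\}_{t\ge1}$ be independent, identically distributed random matrices with values in $\varSigma$, defined on a probability space $(\Omega,\mathscr F,\mathbb P)$, with common law $\mu$ and topological support $\varSigma_\mu$ of $\mu$. Define the left products by $X^{(1)}=X_1$ and $X^{(t+1)}=X_{t+1}X^{(t)}$ for $t\ge 1$. For $t\ge1$ let $\varSigma_\mu^t$ denote the set of all products of $t$ matrices in $\varSigma_\mu$. Let $s=(s_1,\dots,s_n)\in[0,1]^n$ be a constant row vector with $\sum_i s_i=1$, and let $\mathbf 1s$ be the $n\times n$ matrix all of whose rows equal $s$. Then $X^{(t)}$ converges in probability to $\mathbf 1s$ as $t\to\infty$ if and only if $\mathbf 1s$ is the only rank-one matrix in $$\operatorname{closure}\Big(\bigcup_{t=1}^{\infty}\varSigma_\mu^t\Big),$$ that is, $\mathbf 1s$ belongs to this set and every matrix of rank one in it equals $\mathbf 1s$. -/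

import Mathlib

open MeasureTheory ProbabilityTheory Filter Topology
open scoped Pointwise

namespace RandomProducts

/-- The sigma-algebra on real square matrices generated by the entries; it is the Borel
sigma-algebra. -/
instance matrixMeasurableSpace (n : ℕ) : MeasurableSpace (Matrix (Fin n) (Fin n) ℝ) :=
  inferInstanceAs (MeasurableSpace (Fin n → Fin n → ℝ))

instance matrixBorelSpace (n : ℕ) : BorelSpace (Matrix (Fin n) (Fin n) ℝ) :=
  inferInstanceAs (BorelSpace (Fin n → Fin n → ℝ))

/-- The left products `X^(t) = X_t * ⋯ * X_1` of a sequence of random square matrices, so that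
`X^(1) = X_1` and `X^(t+1) = X_{t+1} * X^(t)`. The term `X_0` of the sequence is not used. -/
def leftProd {Ω : Type*} {n : ℕ} (X : ℕ → Ω → Matrix (Fin n) (Fin n) ℝ) :
    ℕ → Ω → Matrix (Fin n) (Fin n) ℝ
  | 0 => fun _ => 1
  | t + 1 => fun ω => X (t + 1) ω * leftProd X t ω

theorem leftProd_one {Ω : Type*} {n : ℕ} (X : ℕ → Ω → Matrix (Fin n) (Fin n) ℝ) :
    leftProd X 1 = X 1 := by
  funext ω
  simp [leftProd]

/-- The closed multiplicative semigroup generated by a set `A` of matrices: the closure of the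
union over `t ≥ 1` of the sets `A ^ t` of all products of `t` elements of `A`. -/
def closedSemigroup {n : ℕ} (A : Set (Matrix (Fin n) (Fin n) ℝ)) :
    Set (Matrix (Fin n) (Fin n) ℝ) :=
  closure (⋃ t : ℕ, ⋃ _ : 1 ≤ t, A ^ t)

section Convergence

open scoped Matrix.Norms.Elementwise

/-- Convergence in probability of a sequence of random matrices to a constant matrix, with respect
to the largest absolute value of an entry (all norms on matrices are equivalent). -/
def ConvergesInProbability {Ω : Type*} [MeasurableSpace Ω] (P : Measure Ω) {n : ℕ}
    (Y : ℕ → Ω → Matrix (Fin n) (Fin n) ℝ) (L : Matrix (Fin n) (Fin n) ℝ) : Prop :=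
  ∀ ε : ℝ, 0 < ε → Tendsto (fun t => P {ω | ε ≤ ‖Y t ω - L‖}) atTop (𝓝 0)

end Convergence

end RandomProducts

/-! Only the laws `mconvPow μ t` of the left products matter. Write `L` for the matrix with all rows
`s`; every stochastic `x` satisfies `x * L = L`. Each side of the equivalence yields `L * x = L` on
the support of `μ`. Under convergence, a fresh factor can be put on the right of a product close to
`L` without changing the limit law (`mul_eq_of_tendsto_mconvPow`); under the rank condition, `L * x`
is a rank-one element of the semigroup. Under convergence `L` is also a limit of products, and a
rank-one element with equal rows `r` equals `L` times itself, hence `L`. Conversely, `L * y = L`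
gives `x * y - L = (x - L) * (y - L)`, so the mean distance to `L` at time `m + t` is at most `q`
times that at time `t` (`lintegral_mconvPow_add_le`). Some `m` has `q < 1`, because products near
`L` carry positive mass; decay is then geometric and Markov's inequality concludes. -/

namespace MeasureTheory.Measure

/-! ### Convolution powers and their supports. -/

variable {M : Type*} [Monoid M] [MeasurableSpace M]

/-- The `t`-fold multiplicative convolution power of a measure on a monoid. -/
noncomputable def mconvPow (μ : Measure M) : ℕ → Measure M
  | 0 => dirac 1
  | t + 1 => μ ∗ₘ mconvPow μ t

variable [MeasurableMul₂ M]

instance isProbabilityMeasure_mconvPow (μ : Measure M) [IsProbabilityMeasure μ] (t : ℕ) :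
    IsProbabilityMeasure (mconvPow μ t) := by
  induction t with
  | zero => exact inferInstanceAs (IsProbabilityMeasure (dirac 1))
  | succ t ih => exact inferInstanceAs (IsProbabilityMeasure (μ ∗ₘ mconvPow μ t))

theorem mconvPow_one (μ : Measure M) [IsProbabilityMeasure μ] : mconvPow μ 1 = μ :=
  mconv_dirac_one μ

theorem mconvPow_add (μ : Measure M) [IsProbabilityMeasure μ] (m t : ℕ) :
    mconvPow μ (m + t) = mconvPow μ m ∗ₘ mconvPow μ t := by
  induction m with
  | zero => rw [Nat.zero_add]; exact (dirac_one_mconv _).symm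
  | succ m ih =>
    rw [Nat.succ_add]
    change μ ∗ₘ mconvPow μ (m + t) = (μ ∗ₘ mconvPow μ m) ∗ₘ mconvPow μ t
    rw [ih, mconv_assoc]

theorem mul_le_mconv {μ ν : Measure M} [SFinite ν] {U V W : Set M} (hW : MeasurableSet W)
    (h : ∀ x ∈ U, ∀ y ∈ V, x * y ∈ W) : μ U * ν V ≤ (μ ∗ₘ ν) W := by
  rw [mconv, map_apply measurable_mul hW, ← prod_prod]
  exact measure_mono fun p hp => h _ hp.1 _ hp.2

theorem ae_mem_mconvPow {μ : Measure M} [IsProbabilityMeasure μ] {N : Submonoid M}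
    (hN : MeasurableSet (N : Set M)) (hμ : ∀ᵐ x ∂μ, x ∈ N) (t : ℕ) :
    ∀ᵐ x ∂mconvPow μ t, x ∈ N := by
  induction t with
  | zero => exact (ae_dirac_iff hN).2 N.one_mem
  | succ t ih =>
    change ∀ᵐ x ∂(μ ∗ₘ mconvPow μ t), x ∈ N
    refine (ae_map_iff (p := (· ∈ N)) measurable_mul.aemeasurable hN).2 ?_
    filter_upwards [quasiMeasurePreserving_fst.ae hμ, quasiMeasurePreserving_snd.ae ih]
      with p h₁ h₂ using N.mul_mem h₁ h₂

variable [TopologicalSpace M] [ContinuousMul M] [OpensMeasurableSpace M]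

/-- A neighbourhood of `x * y` contains a product of neighbourhoods of `x` and `y`, both of positive
mass. -/
theorem mul_mem_support_mconv {μ ν : Measure M} [SFinite ν] {x y : M} (hx : x ∈ μ.support)
    (hy : y ∈ ν.support) : x * y ∈ (μ ∗ₘ ν).support := by
  rw [(nhds_basis_opens _).mem_measureSupport]
  rintro W ⟨hxy, hW⟩
  have hn : (fun p : M × M => p.1 * p.2) ⁻¹' W ∈ 𝓝 (x, y) :=
    (hW.preimage continuous_mul).mem_nhds hxy
  obtain ⟨U, hU, V, hV, hUV⟩ := mem_nhds_prod_iff.1 hn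
  refine lt_of_lt_of_le (ENNReal.mul_pos ?_ ?_)
    (mul_le_mconv hW.measurableSet fun a ha b hb => hUV (Set.mk_mem_prod ha hb))
  · exact ((mem_support_iff_forall x).1 hx U hU).ne'
  · exact ((mem_support_iff_forall y).1 hy V hV).ne'

theorem pow_support_subset_support_mconvPow (μ : Measure M) [IsProbabilityMeasure μ] (t : ℕ) :
    μ.support ^ t ⊆ (mconvPow μ t).support := by
  induction t with
  | zero =>
    rw [pow_zero, Set.one_subset, mem_support_iff_forall]
    intro U hU
    change 0 < dirac (1 : M) U
    rw [dirac_apply_of_mem (mem_of_mem_nhds hU)]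
    exact one_pos
  | succ t ih =>
    rw [pow_succ']
    rintro _ ⟨x, hx, y, hy, rfl⟩
    exact mul_mem_support_mconv hx (ih hy)

end MeasureTheory.Measure

namespace RandomProducts

open Matrix Measure

/-! ### Stochastic matrices, rank one, and the closed semigroup. -/

section Stochastic

variable {n : ℕ}

theorem isClosed_rowStochastic :
    IsClosed (rowStochastic ℝ (Fin n) : Set (Matrix (Fin n) (Fin n) ℝ)) := by
  have h : (rowStochastic ℝ (Fin n) : Set (Matrix (Fin n) (Fin n) ℝ)) =
      (⋂ i, ⋂ j, {M | 0 ≤ M i j}) ∩ {M | M *ᵥ 1 = 1} := by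
    ext M
    simp [mem_rowStochastic]
  rw [h]
  refine IsClosed.inter (isClosed_iInter fun i => isClosed_iInter fun j => ?_) ?_
  · exact isClosed_le continuous_const (continuous_id.matrix_elem i j)
  · exact isClosed_eq (continuous_id.matrix_mulVec continuous_const) continuous_const

theorem mul_vecMulVec_one {σ : Matrix (Fin n) (Fin n) ℝ} (hσ : σ ∈ rowStochastic ℝ (Fin n))
    (r : Fin n → ℝ) : σ * vecMulVec 1 r = vecMulVec 1 r := by
  rw [mul_vecMulVec, hσ.2]

theorem vecMulVec_one_mem_rowStochastic {s : Fin n → ℝ} (hs : s ∈ stdSimplex ℝ (Fin n)) :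
    vecMulVec 1 s ∈ rowStochastic ℝ (Fin n) := by
  rw [mem_rowStochastic_iff_sum]
  exact ⟨fun i j => by simpa [vecMulVec_apply] using hs.1 j,
    fun i => by simpa [vecMulVec_apply] using hs.2⟩

theorem rank_ne_zero_of_mem_rowStochastic [NeZero n] {σ : Matrix (Fin n) (Fin n) ℝ}
    (hσ : σ ∈ rowStochastic ℝ (Fin n)) : σ.rank ≠ 0 := by
  intro h
  have hbot : LinearMap.range σ.mulVecLin = ⊥ := Submodule.finrank_eq_zero.1 h
  have h1 : σ *ᵥ 1 = 0 := by
    simpa using LinearMap.congr_fun (LinearMap.range_eq_bot.1 hbot) 1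
  rw [hσ.2] at h1
  simpa using congrFun h1 0

theorem rank_vecMulVec_one [NeZero n] {r : Fin n → ℝ}
    (hr : vecMulVec 1 r ∈ rowStochastic ℝ (Fin n)) :
    (vecMulVec (1 : Fin n → ℝ) r).rank = 1 :=
  le_antisymm (rank_vecMulVec_le _ _)
    (Nat.one_le_iff_ne_zero.2 (rank_ne_zero_of_mem_rowStochastic hr))

/-- A stochastic matrix of rank one has equal rows. -/
theorem exists_eq_vecMulVec_one {σ : Matrix (Fin n) (Fin n) ℝ}
    (hσ : σ ∈ rowStochastic ℝ (Fin n)) (h : σ.rank = 1) : ∃ r, σ = vecMulVec 1 r := by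
  obtain ⟨v, -, hv⟩ := finrank_eq_one_iff'.1 h
  have key : ∀ w : Fin n → ℝ, ∃ c : ℝ, c • (v : Fin n → ℝ) = σ *ᵥ w := fun w => by
    obtain ⟨c, hc⟩ := hv ⟨σ *ᵥ w, LinearMap.mem_range.2 ⟨w, rfl⟩⟩
    exact ⟨c, congrArg Subtype.val hc⟩
  -- The range is the line through `v` and contains the vector `1`, so `v` is constant with entries
  -- `c⁻¹`; column `j` is `d j` times `v`.
  obtain ⟨c, hc⟩ := key 1
  rw [hσ.2] at hc
  choose d hd using fun j => key (Pi.single j 1)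
  have hv1 : ∀ i, c * (v : Fin n → ℝ) i = 1 := fun i => congrFun hc i
  refine ⟨fun j => d j * c⁻¹, ?_⟩
  ext i j
  have h1 := congrFun (hd j) i
  simp only [Pi.smul_apply, smul_eq_mul, mulVec_single_one, col_apply] at h1
  have hvi : (v : Fin n → ℝ) i = c⁻¹ := eq_inv_of_mul_eq_one_right (hv1 i)
  simp [vecMulVec_apply, ← h1, hvi]

/-- The submonoid of stochastic matrices for which the row vector `s` is stationary. -/
def stationarySubmonoid (s : Fin n → ℝ) : Submonoid (Matrix (Fin n) (Fin n) ℝ) where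
  carrier := {y | y ∈ rowStochastic ℝ (Fin n) ∧ vecMulVec 1 s * y = vecMulVec 1 s}
  one_mem' := ⟨Submonoid.one_mem _, mul_one _⟩
  mul_mem' {a b} ha hb :=
    ⟨Submonoid.mul_mem _ ha.1 hb.1, by rw [← mul_assoc, ha.2, hb.2]⟩

theorem isClosed_stationarySubmonoid (s : Fin n → ℝ) :
    IsClosed (stationarySubmonoid s : Set (Matrix (Fin n) (Fin n) ℝ)) :=
  isClosed_rowStochastic.inter
    (isClosed_eq (continuous_const.matrix_mul continuous_id) continuous_const)

theorem closedSemigroup_subset {A : Set (Matrix (Fin n) (Fin n) ℝ)}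
    {N : Submonoid (Matrix (Fin n) (Fin n) ℝ)}
    (hN : IsClosed (N : Set (Matrix (Fin n) (Fin n) ℝ))) (hA : A ⊆ N) :
    closedSemigroup A ⊆ N := by
  refine closure_minimal (Set.iUnion₂_subset fun t _ => ?_) hN
  induction t with
  | zero => simp
  | succ t ih =>
    rw [pow_succ]
    rintro _ ⟨x, hx, y, hy, rfl⟩
    by_cases ht : 1 ≤ t
    · exact N.mul_mem (ih ht hx) (hA hy)
    · obtain rfl : t = 0 := by omega
      rw [pow_zero, Set.mem_one] at hx
      subst hx
      simpa using hA hy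

theorem mul_mem_closedSemigroup {A : Set (Matrix (Fin n) (Fin n) ℝ)}
    {x y : Matrix (Fin n) (Fin n) ℝ} (hx : x ∈ closedSemigroup A) (hy : y ∈ A) :
    x * y ∈ closedSemigroup A := by
  refine map_mem_closure (f := fun z => z * y) (by fun_prop) hx fun z hz => ?_
  obtain ⟨t, ht, hz⟩ := Set.mem_iUnion₂.1 hz
  exact Set.mem_iUnion₂.2 ⟨t + 1, by omega, by rw [pow_succ]; exact Set.mul_mem_mul hz hy⟩

end Stochastic

/-! ### Contraction towards the limit matrix. -/

section Norm

open scoped Matrix.Norms.Elementwise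

variable {n : ℕ}

theorem norm_mul_le_of_mem_rowStochastic {x : Matrix (Fin n) (Fin n) ℝ}
    (hx : x ∈ rowStochastic ℝ (Fin n)) (z : Matrix (Fin n) (Fin n) ℝ) : ‖x * z‖ ≤ ‖z‖ := by
  refine (norm_le_iff (norm_nonneg _)).2 fun i j => ?_
  rw [mul_apply]
  calc ‖∑ k, x i k * z k j‖ ≤ ∑ k, x i k * ‖z‖ := norm_sum_le_of_le _ fun k _ => by
        rw [norm_mul, Real.norm_of_nonneg (hx.1 i k)]
        exact mul_le_mul_of_nonneg_left (norm_entry_le_entrywise_sup_norm z) (hx.1 i k)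
    _ = ‖z‖ := by rw [← Finset.sum_mul, sum_row_of_mem_rowStochastic hx, one_mul]

theorem norm_mul_le_card_mul (x z : Matrix (Fin n) (Fin n) ℝ) :
    ‖x * z‖ ≤ n * ‖x‖ * ‖z‖ := by
  refine (norm_le_iff (by positivity)).2 fun i j => ?_
  rw [mul_apply]
  calc ‖∑ k, x i k * z k j‖ ≤ ∑ _k : Fin n, ‖x‖ * ‖z‖ := norm_sum_le_of_le _ fun k _ => by
        rw [norm_mul]
        exact mul_le_mul (norm_entry_le_entrywise_sup_norm x) (norm_entry_le_entrywise_sup_norm z)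
          (norm_nonneg _) (norm_nonneg _)
    _ = n * ‖x‖ * ‖z‖ := by simp [mul_assoc]

/-- Left multiplication by `x` contracts the distance to `vecMulVec 1 s` by the factor
`min 1 (n * ‖x - vecMulVec 1 s‖)`. -/
theorem norm_mul_sub_le {s : Fin n → ℝ} {x y : Matrix (Fin n) (Fin n) ℝ}
    (hs : s ∈ stdSimplex ℝ (Fin n))
    (hx : x ∈ rowStochastic ℝ (Fin n)) (hy : y ∈ stationarySubmonoid s) :
    ‖x * y - vecMulVec 1 s‖ ≤ min 1 (n * ‖x - vecMulVec 1 s‖) * ‖y - vecMulVec 1 s‖ := by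
  have hxL := mul_vecMulVec_one hx s
  have hLL := mul_vecMulVec_one (vecMulVec_one_mem_rowStochastic hs) s
  -- The factor `1` comes from `x * (y - L) = x * y - L`, rows of `x` being averages; the other from
  -- `(x - L) * (y - L) = x * y - L`.
  rcases min_choice 1 (n * ‖x - vecMulVec 1 s‖) with h | h <;> rw [h]
  · rw [one_mul]
    have := norm_mul_le_of_mem_rowStochastic hx (y - vecMulVec 1 s)
    rwa [mul_sub, hxL] at this
  · have := norm_mul_le_card_mul (x - vecMulVec 1 s) (y - vecMulVec 1 s)
    rwa [mul_sub, sub_mul, sub_mul, hxL, hLL, hy.2, sub_self, sub_zero] at this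

end Norm

/-! ### The law of the left product. -/

section Laws

instance matrixSecondCountableTopology (n : ℕ) :
    SecondCountableTopology (Matrix (Fin n) (Fin n) ℝ) :=
  inferInstanceAs (SecondCountableTopology (Fin n → Fin n → ℝ))

variable {Ω : Type*} [MeasurableSpace Ω] {n : ℕ} {X : ℕ → Ω → Matrix (Fin n) (Fin n) ℝ}

theorem measurable_leftProd (hX : ∀ t, 1 ≤ t → Measurable (X t)) (t : ℕ) :
    Measurable (leftProd X t) := by
  induction t with
  | zero => exact measurable_const
  | succ t ih => exact (hX (t + 1) (by omega)).mul ih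

omit [MeasurableSpace Ω] in
theorem leftProd_congr {Ω' : Type*} {Y : ℕ → Ω' → Matrix (Fin n) (Fin n) ℝ} {ω : Ω} {ω' : Ω'}
    {t : ℕ} (h : ∀ i, 1 ≤ i → i ≤ t → X i ω = Y i ω') : leftProd X t ω = leftProd Y t ω' := by
  induction t with
  | zero => rfl
  | succ t ih =>
    simp only [leftProd]
    rw [h (t + 1) (by omega) le_rfl, ih fun i hi hit => h i hi (by omega)]

theorem indepFun_leftProd {P : Measure Ω} (hX : ∀ t, 1 ≤ t → Measurable (X t))
    (hind : iIndepFun (fun t : {t : ℕ // 1 ≤ t} => X t) P) (t : ℕ) :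
    IndepFun (X (t + 1)) (leftProd X t) P := by
  let a : {t : ℕ // 1 ≤ t} := ⟨t + 1, by omega⟩
  let S : Finset {t : ℕ // 1 ≤ t} := {a}
  let T : Finset {t : ℕ // 1 ≤ t} := (Finset.Icc 1 t).subtype (1 ≤ ·)
  have hST : Disjoint S T := by
    rw [Finset.disjoint_singleton_left]
    simp [T, a]
  -- This writes `leftProd X t` as a function of the finitely many coordinates in `T`; the value `1`
  -- off `T` is never read.
  let Y : ℕ → (T → Matrix (Fin n) (Fin n) ℝ) → Matrix (Fin n) (Fin n) ℝ := fun i w =>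
    if h : ∃ h : 1 ≤ i, (⟨i, h⟩ : {t : ℕ // 1 ≤ t}) ∈ T then w ⟨⟨i, h.1⟩, h.2⟩ else 1
  have hY : ∀ i, 1 ≤ i → Measurable (Y i) := fun i _ => by
    by_cases h : ∃ h : 1 ≤ i, (⟨i, h⟩ : {t : ℕ // 1 ≤ t}) ∈ T
    · simpa only [Y, dif_pos h] using measurable_pi_apply _
    · simpa only [Y, dif_neg h] using measurable_const
  have hφ : Measurable fun w : S → Matrix (Fin n) (Fin n) ℝ =>
      w ⟨a, Finset.mem_singleton_self a⟩ := measurable_pi_apply _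
  have key := (hind.indepFun_finset S T hST fun i => hX i i.2).comp hφ (measurable_leftProd hY t)
  have hcomp : leftProd X t = leftProd Y t ∘ fun ω i => X i ω := funext fun ω =>
    leftProd_congr fun i hi hit => by
      have h : ∃ h : 1 ≤ i, (⟨i, h⟩ : {t : ℕ // 1 ≤ t}) ∈ T := ⟨hi, by simp [T, hi, hit]⟩
      simp only [Y, dif_pos h]
  rw [hcomp]
  exact key

theorem map_leftProd {P : Measure Ω} [IsProbabilityMeasure P]
    (hX : ∀ t, 1 ≤ t → Measurable (X t))
    (hind : iIndepFun (fun t : {t : ℕ // 1 ≤ t} => X t) P)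
    {μ : Measure (Matrix (Fin n) (Fin n) ℝ)} (hlaw : ∀ t, 1 ≤ t → P.map (X t) = μ) (t : ℕ) :
    P.map (leftProd X t) = mconvPow μ t := by
  induction t with
  | zero => simp [leftProd, mconvPow]
  | succ t ih =>
    have h := (indepFun_leftProd hX hind t).map_mul_eq_map_mconv_map
      (hX (t + 1) (by omega)) (measurable_leftProd hX t)
    rw [hlaw (t + 1) (by omega), ih] at h
    exact h

end Laws

/-! ### Concentration of the convolution powers. -/

section Convergence

open scoped Matrix.Norms.Elementwise

variable {n : ℕ} {μ : Measure (Matrix (Fin n) (Fin n) ℝ)} [IsProbabilityMeasure μ]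
  {s : Fin n → ℝ}

theorem continuous_norm_matrix : Continuous fun z : Matrix (Fin n) (Fin n) ℝ => ‖z‖ :=
  continuous_norm (E := Fin n → Fin n → ℝ)

theorem continuous_norm_sub (L : Matrix (Fin n) (Fin n) ℝ) :
    Continuous fun z : Matrix (Fin n) (Fin n) ℝ => ‖z - L‖ :=
  continuous_norm_matrix.comp (continuous_id.sub continuous_const)

theorem measurable_norm_sub (L : Matrix (Fin n) (Fin n) ℝ) :
    Measurable fun z : Matrix (Fin n) (Fin n) ℝ => ‖z - L‖ :=
  (continuous_norm_sub L).measurable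

theorem exists_norm_sub_lt_of_mem_nhds {L : Matrix (Fin n) (Fin n) ℝ}
    {U : Set (Matrix (Fin n) (Fin n) ℝ)} (hU : U ∈ 𝓝 L) :
    ∃ δ : ℝ, 0 < δ ∧ ∀ z, ‖z - L‖ < δ → z ∈ U := by
  obtain ⟨δ, hδ, hball⟩ := (Metric.mem_nhds_iff (α := Fin n → Fin n → ℝ)).1 hU
  exact ⟨δ, hδ, fun z hz => hball (mem_ball_iff_norm.2 hz)⟩

/-- If the convolution powers of `μ` concentrate at `L`, then `L` absorbs the support of `μ` from
the right. -/
theorem mul_eq_of_tendsto_mconvPow {L : Matrix (Fin n) (Fin n) ℝ}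
    (h : ∀ ε : ℝ, 0 < ε → Tendsto (fun t => mconvPow μ t {z | ε ≤ ‖z - L‖}) atTop (𝓝 0))
    {x : Matrix (Fin n) (Fin n) ℝ} (hx : x ∈ μ.support) : L * x = L := by
  by_contra hne
  have hpos : 0 < ‖L * x - L‖ := norm_pos_iff.2 (sub_ne_zero.2 hne)
  obtain ⟨ε, hε, hεx⟩ := exists_between hpos
  have hn : {p : Matrix (Fin n) (Fin n) ℝ × Matrix (Fin n) (Fin n) ℝ | ε < ‖p.1 * p.2 - L‖}
      ∈ 𝓝 (L, x) :=
    ((isOpen_lt continuous_const (continuous_norm_sub L)).preimage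
      (continuous_fst.matrix_mul continuous_snd)).mem_nhds hεx
  obtain ⟨U, hU, V, hV, hUV⟩ := mem_nhds_prod_iff.1 hn
  obtain ⟨δ, hδ, hball⟩ := exists_norm_sub_lt_of_mem_nhds hU
  have hW : MeasurableSet {z : Matrix (Fin n) (Fin n) ℝ | ε ≤ ‖z - L‖} :=
    measurableSet_le measurable_const (measurable_norm_sub L)
  have hD : MeasurableSet {z : Matrix (Fin n) (Fin n) ℝ | δ ≤ ‖z - L‖} :=
    measurableSet_le measurable_const (measurable_norm_sub L)
  -- A left factor near `L` times a right factor near `x` stays at distance more than `ε` from `L`.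
  have hle : ∀ t, (1 - mconvPow μ t {z | δ ≤ ‖z - L‖}) * μ V ≤
      mconvPow μ (t + 1) {z | ε ≤ ‖z - L‖} := fun t => by
    have hsub : ∀ a ∈ {z : Matrix (Fin n) (Fin n) ℝ | δ ≤ ‖z - L‖}ᶜ, ∀ b ∈ V,
        a * b ∈ {z : Matrix (Fin n) (Fin n) ℝ | ε ≤ ‖z - L‖} := fun a ha b hb => by
      rw [Set.mem_compl_iff, Set.mem_ofPred_eq, not_le] at ha
      have hab := hUV (Set.mk_mem_prod (hball a ha) hb)
      rw [Set.mem_ofPred_eq] at hab ⊢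
      exact hab.le
    have hconv := mul_le_mconv (μ := mconvPow μ t) (ν := μ) hW hsub
    -- The new factor stands on the right, whereas `leftProd` multiplies on the left; the law is the
    -- same.
    have hpow : mconvPow μ (t + 1) = mconvPow μ t ∗ₘ μ := by
      rw [mconvPow_add, mconvPow_one]
    rwa [prob_compl_eq_one_sub hD, ← hpow] at hconv
  have hl : Tendsto (fun t => (1 - mconvPow μ t {z | δ ≤ ‖z - L‖}) * μ V) atTop
      (𝓝 ((1 - 0) * μ V)) :=
    ENNReal.Tendsto.mul_const
      (ENNReal.Tendsto.sub tendsto_const_nhds (h δ hδ) (Or.inl ENNReal.one_ne_top))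
      (Or.inr (measure_ne_top _ _))
  have hr := (tendsto_add_atTop_iff_nat 1).2 (h ε hε)
  have := le_of_tendsto_of_tendsto' hl hr hle
  rw [tsub_zero, one_mul] at this
  exact this.not_gt ((mem_support_iff_forall x).1 hx V hV)

omit [IsProbabilityMeasure μ] in
-- The closure makes the set measurable, and it survives multiplication by a support element by
-- continuity.
theorem ae_mem_closure_pow_support (t : ℕ) : ∀ᵐ x ∂mconvPow μ t, x ∈ closure (μ.support ^ t) := by
  induction t with
  | zero => exact (ae_dirac_iff isClosed_closure.measurableSet).2 (subset_closure (by simp))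
  | succ t ih =>
    change ∀ᵐ x ∂(μ ∗ₘ mconvPow μ t), x ∈ closure (μ.support ^ (t + 1))
    refine (ae_map_iff (p := (· ∈ closure (μ.support ^ (t + 1)))) measurable_mul.aemeasurable
      isClosed_closure.measurableSet).2 ?_
    filter_upwards [quasiMeasurePreserving_fst.ae (support_mem_ae (μ := μ)),
      quasiMeasurePreserving_snd.ae ih] with p h₁ h₂
    rw [pow_succ']
    exact map_mem_closure (f := fun z => p.1 * z) (by fun_prop) h₂
      fun z hz => Set.mul_mem_mul h₁ hz

theorem mem_closedSemigroup_of_tendsto_mconvPow {L : Matrix (Fin n) (Fin n) ℝ}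
    (h : ∀ ε : ℝ, 0 < ε → Tendsto (fun t => mconvPow μ t {z | ε ≤ ‖z - L‖}) atTop (𝓝 0)) :
    L ∈ closedSemigroup μ.support := by
  rw [closedSemigroup, ← closure_closure]
  refine mem_closure_iff_nhds.2 fun U hU => ?_
  obtain ⟨ε, hε, hεU⟩ := exists_norm_sub_lt_of_mem_nhds hU
  obtain ⟨t, hlt, ht⟩ :=
    (((h ε hε).eventually_lt_const one_pos).and (eventually_ge_atTop 1)).exists
  have hfreq : ∃ᵐ z ∂mconvPow μ t, ¬ ε ≤ ‖z - L‖ := by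
    intro hall
    have hall : ∀ᵐ z ∂mconvPow μ t, ε ≤ ‖z - L‖ := hall.mono fun z hz => not_not.1 hz
    exact hlt.ne (mem_ae_iff_prob_eq_one (measurableSet_le measurable_const (measurable_norm_sub L)) |>.1 hall)
  obtain ⟨z, hz, hzA⟩ := (hfreq.and_eventually (ae_mem_closure_pow_support t)).exists
  exact ⟨z, hεU z (not_le.1 hz),
    closure_mono (Set.subset_iUnion₂_of_subset t ht subset_rfl) hzA⟩

omit [IsProbabilityMeasure μ] in
theorem tendsto_mconvPow_of_tendsto_lintegral {L : Matrix (Fin n) (Fin n) ℝ}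
    (h : Tendsto (fun t => ∫⁻ z, ENNReal.ofReal ‖z - L‖ ∂mconvPow μ t) atTop (𝓝 0))
    (ε : ℝ) (hε : 0 < ε) :
    Tendsto (fun t => mconvPow μ t {z | ε ≤ ‖z - L‖}) atTop (𝓝 0) := by
  have hε0 : ENNReal.ofReal ε ≠ 0 := (ENNReal.ofReal_pos.2 hε).ne'
  have hlim := ENNReal.Tendsto.div_const h (Or.inr hε0)
  rw [ENNReal.zero_div] at hlim
  refine tendsto_of_tendsto_of_tendsto_of_le_of_le tendsto_const_nhds hlim
    (fun _ => zero_le) fun t => ?_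
  refine le_trans (measure_mono fun z hz => ENNReal.ofReal_le_ofReal hz)
    (meas_ge_le_lintegral_div (measurable_norm_sub L).ennreal_ofReal.aemeasurable hε0
      ENNReal.ofReal_ne_top)

omit [IsProbabilityMeasure μ] in
theorem convergesInProbability_leftProd_iff {Ω : Type*} [MeasurableSpace Ω] {P : Measure Ω}
    [IsProbabilityMeasure P] {X : ℕ → Ω → Matrix (Fin n) (Fin n) ℝ}
    (hX : ∀ t, 1 ≤ t → Measurable (X t))
    (hind : iIndepFun (fun t : {t : ℕ // 1 ≤ t} => X t) P)
    (hlaw : ∀ t, 1 ≤ t → P.map (X t) = μ) {L : Matrix (Fin n) (Fin n) ℝ} :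
    ConvergesInProbability P (leftProd X) L ↔
      ∀ ε : ℝ, 0 < ε → Tendsto (fun t => mconvPow μ t {z | ε ≤ ‖z - L‖}) atTop (𝓝 0) := by
  refine forall₂_congr fun ε _ => ?_
  have h : ∀ t, mconvPow μ t {z | ε ≤ ‖z - L‖} = P {ω | ε ≤ ‖leftProd X t ω - L‖} := fun t => by
    rw [← map_leftProd hX hind hlaw, Measure.map_apply (measurable_leftProd hX t)
      (measurableSet_le measurable_const (measurable_norm_sub L))]
    rfl
  simp only [h]

theorem lintegral_mconvPow_add_le (hs : s ∈ stdSimplex ℝ (Fin n))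
    (hμ : ∀ᵐ x ∂μ, x ∈ stationarySubmonoid s) (m t : ℕ) :
    ∫⁻ z, ENNReal.ofReal ‖z - vecMulVec 1 s‖ ∂mconvPow μ (m + t) ≤
      (∫⁻ x, ENNReal.ofReal (min 1 (n * ‖x - vecMulVec 1 s‖)) ∂mconvPow μ m) *
        ∫⁻ z, ENNReal.ofReal ‖z - vecMulVec 1 s‖ ∂mconvPow μ t := by
  have hae := ae_mem_mconvPow (isClosed_stationarySubmonoid s).measurableSet hμ
  have hm := (measurable_norm_sub (vecMulVec 1 s)).ennreal_ofReal
  have hc : Measurable fun x : Matrix (Fin n) (Fin n) ℝ =>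
      ENNReal.ofReal (min 1 (n * ‖x - vecMulVec 1 s‖)) :=
    (measurable_const.min ((measurable_norm_sub _).const_mul _)).ennreal_ofReal
  rw [mconvPow_add, lintegral_mconv hm, ← lintegral_mul_const _ hc]
  refine lintegral_mono_ae ((hae m).mono fun x hx => ?_)
  rw [← lintegral_const_mul _ hm]
  refine lintegral_mono_ae ((hae t).mono fun y hy => ?_)
  rw [← ENNReal.ofReal_mul (by positivity)]
  exact ENNReal.ofReal_le_ofReal (norm_mul_sub_le hs hx.1 hy)

/-- The integrand is at most `1`, and strictly smaller on a neighbourhood of `L`. That neighbourhood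
contains a product of `m` support elements, so it has positive mass. -/
theorem exists_lintegral_contraction_lt_one
    (hL : vecMulVec 1 s ∈ closedSemigroup μ.support) :
    ∃ m, ∫⁻ x, ENNReal.ofReal (min 1 (n * ‖x - vecMulVec 1 s‖)) ∂mconvPow μ m < 1 := by
  let U : Set (Matrix (Fin n) (Fin n) ℝ) := {x | n * ‖x - vecMulVec 1 s‖ < 1}
  have hU : IsOpen U :=
    isOpen_lt (continuous_const.mul (continuous_norm_sub _)) continuous_const
  obtain ⟨x, hxU, hx⟩ := mem_closure_iff.1 hL U hU (by simp [U])
  obtain ⟨m, -, hx⟩ := Set.mem_iUnion₂.1 hx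
  have hpos := (mem_support_iff_forall x).1 (pow_support_subset_support_mconvPow μ m hx) U
    (hU.mem_nhds hxU)
  refine ⟨m, ?_⟩
  have h1 : ∫⁻ _, 1 ∂mconvPow μ m = 1 := by simp
  have hle : ∀ x : Matrix (Fin n) (Fin n) ℝ,
      ENNReal.ofReal (min 1 (n * ‖x - vecMulVec 1 s‖)) ≤ 1 := fun x =>
    ENNReal.ofReal_le_one.2 (min_le_left _ _)
  conv_rhs => rw [← h1]
  refine lintegral_strict_mono_of_ae_le_of_ae_lt_on aemeasurable_const ?_
    (ae_of_all _ hle) hpos.ne' (ae_of_all _ fun x hx => ?_)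
  · refine ne_top_of_le_ne_top ENNReal.one_ne_top ?_
    rw [← h1]
    exact lintegral_mono hle
  · rw [ENNReal.ofReal_lt_one]
    exact min_lt_of_right_lt hx

theorem tendsto_lintegral_mconvPow (hs : s ∈ stdSimplex ℝ (Fin n))
    (hμ : ∀ᵐ x ∂μ, x ∈ stationarySubmonoid s)
    (hL : vecMulVec 1 s ∈ closedSemigroup μ.support) :
    Tendsto (fun t => ∫⁻ z, ENNReal.ofReal ‖z - vecMulVec 1 s‖ ∂mconvPow μ t) atTop (𝓝 0) := by
  obtain ⟨m, hm⟩ := exists_lintegral_contraction_lt_one hL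
  set q := ∫⁻ x, ENNReal.ofReal (min 1 (n * ‖x - vecMulVec 1 s‖)) ∂mconvPow μ m
  set e : ℕ → ENNReal := fun t => ∫⁻ z, ENNReal.ofReal ‖z - vecMulVec 1 s‖ ∂mconvPow μ t
  -- Decay is geometric only along multiples of `m`; monotonicity, the one-step bound with factor at
  -- most `1`, fills the gaps.
  have hanti : Antitone e := antitone_nat_of_succ_le fun t => by
    have h := lintegral_mconvPow_add_le hs hμ 1 t
    rw [add_comm 1 t] at h
    refine h.trans (mul_le_of_le_one_left' ?_)
    refine (lintegral_mono fun x => ENNReal.ofReal_le_one.2 (min_le_left _ _)).trans ?_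
    simp
  have hgeom : ∀ k, e (k * m) ≤ q ^ k * e 0 := fun k => by
    induction k with
    | zero => simp
    | succ k ih =>
      rw [Nat.succ_mul, add_comm, pow_succ', mul_assoc]
      exact (lintegral_mconvPow_add_le hs hμ m (k * m)).trans (mul_le_mul_right ih q)
  have he0 : e 0 ≠ ⊤ := by
    change ∫⁻ z, ENNReal.ofReal ‖z - vecMulVec 1 s‖ ∂Measure.dirac 1 ≠ ⊤
    rw [lintegral_dirac' _ (measurable_norm_sub _).ennreal_ofReal]
    exact ENNReal.ofReal_ne_top
  have hlim : Tendsto (fun k => q ^ k * e 0) atTop (𝓝 0) := by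
    have := ENNReal.Tendsto.mul_const (ENNReal.tendsto_pow_atTop_nhds_zero_of_lt_one hm)
      (Or.inr he0)
    rwa [zero_mul] at this
  rw [ENNReal.tendsto_nhds_zero] at hlim ⊢
  intro ε hε
  obtain ⟨k, hk⟩ := (hlim ε hε).exists
  filter_upwards [eventually_ge_atTop (k * m)] with t ht
  exact (hanti ht).trans ((hgeom k).trans hk)

end Convergence

end RandomProducts

/-! ### The equivalence. -/

theorem proposition1 {Ω : Type*} [MeasurableSpace Ω] (P : Measure Ω) [IsProbabilityMeasure P]
    (n : ℕ) (X : ℕ → Ω → Matrix (Fin n) (Fin n) ℝ)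
    (hX_meas : ∀ t, 1 ≤ t → Measurable (X t))
    (hX_stoch : ∀ t, 1 ≤ t → ∀ ω, X t ω ∈ Matrix.rowStochastic ℝ (Fin n))
    (hX_indep : iIndepFun (fun t : {t : ℕ // 1 ≤ t} => X t) P)
    (μ : Measure (Matrix (Fin n) (Fin n) ℝ))
    (hX_law : ∀ t, 1 ≤ t → P.map (X t) = μ)
    (s : Fin n → ℝ) (hs : s ∈ stdSimplex ℝ (Fin n)) :
    RandomProducts.ConvergesInProbability P (RandomProducts.leftProd X) (Matrix.vecMulVec 1 s) ↔
      {σ ∈ RandomProducts.closedSemigroup μ.support | σ.rank = 1} = {Matrix.vecMulVec 1 s} := by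
  have : IsProbabilityMeasure μ := by
    rw [← hX_law 1 le_rfl]
    exact Measure.isProbabilityMeasure_map (hX_meas 1 le_rfl).aemeasurable
  have : NeZero n := ⟨by
    rintro rfl
    simpa using hs.2⟩
  have hLs := RandomProducts.vecMulVec_one_mem_rowStochastic hs
  have hsupp : μ.support ⊆ (Matrix.rowStochastic ℝ (Fin n) : Set (Matrix (Fin n) (Fin n) ℝ)) := by
    refine Measure.support_subset_of_isClosed RandomProducts.isClosed_rowStochastic ?_
    rw [← hX_law 1 le_rfl]
    exact (ae_map_iff (hX_meas 1 le_rfl).aemeasurable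
      RandomProducts.isClosed_rowStochastic.measurableSet).2 (ae_of_all _ (hX_stoch 1 le_rfl))
  rw [RandomProducts.convergesInProbability_leftProd_iff hX_meas hX_indep hX_law]
  constructor
  · intro h
    have hmem : Matrix.vecMulVec 1 s ∈ RandomProducts.closedSemigroup μ.support :=
      RandomProducts.mem_closedSemigroup_of_tendsto_mconvPow h
    refine Set.Subset.antisymm ?_ ?_
    · rintro σ ⟨hσ, hrank⟩
      have hN := RandomProducts.closedSemigroup_subset
        (RandomProducts.isClosed_stationarySubmonoid s)
        (fun x hx => ⟨hsupp hx, RandomProducts.mul_eq_of_tendsto_mconvPow h hx⟩) hσ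
      obtain ⟨r, rfl⟩ := RandomProducts.exists_eq_vecMulVec_one hN.1 hrank
      -- The product of `L` and the matrix with rows `r` is the latter by stochasticity and `L` by
      -- stationarity.
      exact (RandomProducts.mul_vecMulVec_one hLs r).symm.trans hN.2
    · rintro _ rfl
      exact ⟨hmem, RandomProducts.rank_vecMulVec_one hLs⟩
  · intro h
    have hmem : Matrix.vecMulVec 1 s ∈ RandomProducts.closedSemigroup μ.support :=
      (h.symm.subset rfl).1
    have hN : ∀ x ∈ μ.support, x ∈ RandomProducts.stationarySubmonoid s := fun x hx => by
      refine ⟨hsupp hx, h.subset ⟨RandomProducts.mul_mem_closedSemigroup hmem hx, ?_⟩⟩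
      have hLx := Submonoid.mul_mem _ hLs (hsupp hx)
      -- `L * x` again has equal rows, namely `s` times `x`, and is stochastic, hence of rank one.
      rw [Matrix.vecMulVec_mul] at hLx ⊢
      exact RandomProducts.rank_vecMulVec_one hLx
    exact RandomProducts.tendsto_mconvPow_of_tendsto_lintegral
      (RandomProducts.tendsto_lintegral_mconvPow hs
        (Filter.mem_of_superset Measure.support_mem_ae hN) hmem)
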